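/- Let $N\ge 1$, let $m\ge 1$ be an integer, and let $\bar\gamma>0$, $T>0$, $0\le\rho<1$. Consider decode-and-forward relay selection with $N$ relays in Nakagami-$m$ fading. The source–relay SNRs $\gamma_{SR_1},\dots,\gamma_{SR_N}$ are i.i.d. gamma random variables with shape $m$ and mean $\bar\gamma$, i.e. with density $\frac{m^m x^{m-1}}{\bar\gamma^m\Gamma(m)}e^{-mx/\bar\gamma}$ on $x>0$. The pairs $(\hat\gamma_{R_iD},\gamma_{R_iD})$ of estimated and actual relay–destination SNRs, $i=1,\dots,N$, are i.i.d., are independent of the family of source–relay SNRs, and have the bivariate gamma density (outdated CSI, or noisy CSI in the high-SNR model) $$f_{\hat\gamma,\gamma}(x_1,x_2)=\sum_{j=0}^{\infty}\frac{(m)_j\,m^{2m+2j}\rho^j}{j!\,(1-\rho)^{m+2j}}\prod_{i=1}^{2}\frac{x_i^{m+j-1}\exp\left(-\frac{m x_i}{(1-\rho)\bar\gamma}\right)}{\Gamma(m+j)\,\bar\gamma^{m+j}},\qquad x_1,x_2>0,$$ where $(m)_j$ is the Pochhammer symbol. Let $\mathcal S=\{i:\gamma_{SR_i}>T\}$ be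 the decoding set and, when $\mathcal S\ne\emptyset$, let the selected relay be $\kappa\in\arg\max_{i\in\mathcal S}\hat\gamma_{R_iD}$ (ties broken in any measurable way). The overall SNR is $\min(\gamma_{SR_\kappa},\gamma_{R_\kappa D})$ if $\mathcal S\neq\emptyset$ and $0$ if $\mathcal S=\emptyset$; the outage probability $P_{out}$ is the probability that the overall SNR is less than $T$ (equivalently, that $\mathcal S=\emptyset$, or $\mathcal S\ne\emptyset$ and $\gamma_{R_\kappa D}<T$). Write $\Gamma(s,x)=\int_x^\infty t^{s-1}e^{-t}\,dt$ for the upper incomplete gamma function and, for integers $x\ge1$, $i\ge 0$, put $$\psi(x,\rho,i)=\frac{\Gamma(i+1)}{\left(\frac1{1-\rho}+i\right)^{x}}\sum_{\substack{\xi_0,\dots,\xi_{m-1}\ge 0\\ \xi_0+\dots+\xi_{m-1}=i}}\left(\prod_{k=0}^{m-1}\frac{\left(\frac{1}{k!\,\left(\frac1{1-\rho}+i\right)^{k}}\right)^{\xi_k}}{\Gamma(\xi_k+1)}\right)\left(x-1+\sum_{q=0}^{m-1}q\,\xi_q\right)!.$$ Then, the series over $j$ being convergent, $$\begin{aligned}P_{out}=&\left(1-\frac{\Gamma(m,\frac{m}{\bar\gamma}T)}{\Gamma(m)}\right)^{N}+\sum_{j=0}^{\infty}\sum_{l=1}^{N}\sum_{i=0}^{l-1}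 l\binom Nl\left(1-\frac{\Gamma(m,\frac{m}{\bar\gamma}T)}{\Gamma(m)}\right)^{N-l}\left(\frac{\Gamma(m,\frac{m}{\bar\gamma}T)}{\Gamma(m)}\right)^{l}\\&\times\frac{\rho^j(-1)^i}{j!\,(1-\rho)^j\,\Gamma(m)\,\Gamma(m+j)}\left(\Gamma(m+j)-\Gamma\left(m+j,\tfrac{mT}{(1-\rho)\bar\gamma}\right)\right)\binom{l-1}{i}\,\psi(m+j,\rho,i).\end{aligned}$$ Moreover, with $I(\mu,\alpha,m,\beta,i)=\int_0^\infty x^{\mu}e^{-\alpha x}\,\Gamma(m,\beta x)^{i}\,dx$, for all integers $j,i\ge0$, $$I\left(m+j-1,\tfrac{m}{(1-\rho)\bar\gamma},m,\tfrac m{\bar\gamma},i\right)=\Gamma(m)^i\left(\frac{\bar\gamma}{m}\right)^{m+j}\psi(m+j,\rho,i).$$ -/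

import Mathlib

open MeasureTheory ProbabilityTheory

noncomputable section

namespace RelaySelection

/-- The upper incomplete gamma function `Γ(s, x) = ∫_x^∞ t^(s-1) e^(-t) dt`. -/
def upperGamma (s x : ℝ) : ℝ :=
  ∫ t in Set.Ioi x, t ^ (s - 1) * Real.exp (-t)

/-- The bivariate gamma density of the estimated and the actual SNR of one link, with integer
fading parameter `m`, average SNR `g` (for both coordinates) and correlation coefficient `ρ`. -/
def bivariateGammaPDF (m : ℕ) (g ρ : ℝ) (x : ℝ × ℝ) : ℝ :=
  if 0 < x.1 ∧ 0 < x.2 then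
    ∑' j : ℕ,
      ((ascPochhammer ℝ j).eval (m : ℝ) * (m : ℝ) ^ (2 * m + 2 * j) * ρ ^ j /
          ((Nat.factorial j : ℝ) * (1 - ρ) ^ (m + 2 * j))) *
        ((x.1 ^ (m + j - 1) * Real.exp (-(m * x.1 / ((1 - ρ) * g))) /
            (Real.Gamma ((m : ℝ) + j) * g ^ (m + j))) *
          (x.2 ^ (m + j - 1) * Real.exp (-(m * x.2 / ((1 - ρ) * g))) /
            (Real.Gamma ((m : ℝ) + j) * g ^ (m + j))))
  else 0

/-- The bivariate gamma law on `ℝ × ℝ`. -/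
def bivariateGammaMeasure (m : ℕ) (g ρ : ℝ) : Measure (ℝ × ℝ) :=
  (volume : Measure (ℝ × ℝ)).withDensity
    (fun x => ENNReal.ofReal (bivariateGammaPDF m g ρ x))

/-- The auxiliary integral `I(μ, α, m, β, j) = ∫_0^∞ x^μ e^(-α x) Γ(m, β x)^j dx`. -/
def auxIntegral (k : ℕ) (α : ℝ) (m : ℕ) (β : ℝ) (j : ℕ) : ℝ :=
  ∫ x in Set.Ioi (0 : ℝ), x ^ k * Real.exp (-(α * x)) * upperGamma m (β * x) ^ j

/-- The multinomial sum `ψ(x, ρ, i)` (for fading parameter `m`); the sum runs over all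
`(ξ_0, …, ξ_{m-1})` of natural numbers with `ξ_0 + … + ξ_{m-1} = i`. -/
def psi (m x : ℕ) (ρ : ℝ) (i : ℕ) : ℝ :=
  Real.Gamma ((i : ℝ) + 1) / (1 / (1 - ρ) + i) ^ x *
    ∑ ξ ∈ Finset.piAntidiag (Finset.univ : Finset (Fin m)) i,
      (∏ k : Fin m,
        (1 / ((Nat.factorial (k : ℕ) : ℝ) * (1 / (1 - ρ) + i) ^ (k : ℕ))) ^ (ξ k) /
          Real.Gamma ((ξ k : ℝ) + 1)) *
        (Nat.factorial (x - 1 + ∑ q : Fin m, (q : ℕ) * ξ q) : ℝ)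

variable {Ω : Type*} {N : ℕ}

/-- The decoding set: the relays whose source-relay SNR exceeds the threshold. -/
def decodingSet (T : ℝ) (snrSR : Fin N → Ω → ℝ) (ω : Ω) : Finset (Fin N) :=
  Finset.univ.filter (fun i => T < snrSR i ω)

/-- `κ` is the index of a relay in the decoding set with the largest estimated relay-destination
SNR, whenever the decoding set is nonempty. -/
def IsSelectedRelay (T : ℝ) (snrSR estRD : Fin N → Ω → ℝ) (κ : Ω → Fin N) : Prop :=
  ∀ ω, (decodingSet T snrSR ω).Nonempty →
    κ ω ∈ decodingSet T snrSR ω ∧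
      ∀ i ∈ decodingSet T snrSR ω, estRD i ω ≤ estRD (κ ω) ω

/-- The overall SNR of decode-and-forward transmission through the selected relay; it is zero if
no relay decodes. -/
def endToEndSNR (T : ℝ) (snrSR snrRD : Fin N → Ω → ℝ) (κ : Ω → Fin N) (ω : Ω) : ℝ :=
  if (decodingSet T snrSR ω).Nonempty then min (snrSR (κ ω) ω) (snrRD (κ ω) ω) else 0

/-- The outage probability: the probability that the overall SNR lies below the threshold. -/
def outageProbability [MeasurableSpace Ω] (P : Measure Ω) (T : ℝ)
    (snrSR snrRD : Fin N → Ω → ℝ) (κ : Ω → Fin N) : ℝ :=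
  P.real {ω | endToEndSNR T snrSR snrRD κ ω < T}

/-- The `j`-th term of the series for the outage probability. -/
def outageTerm (N m : ℕ) (g ρ T : ℝ) (j : ℕ) : ℝ :=
  ∑ l ∈ Finset.Icc 1 N, ∑ i ∈ Finset.range l,
    (l : ℝ) * (N.choose l : ℝ) *
      (1 - upperGamma m (m / g * T) / Real.Gamma m) ^ (N - l) *
      (upperGamma m (m / g * T) / Real.Gamma m) ^ l *
      (ρ ^ j * (-1) ^ i /
        ((Nat.factorial j : ℝ) * (1 - ρ) ^ j * Real.Gamma m * Real.Gamma ((m : ℝ) + j))) *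
      (Real.Gamma ((m : ℝ) + j) - upperGamma ((m : ℝ) + j) (m * T / ((1 - ρ) * g))) *
      ((l - 1).choose i : ℝ) * psi m (m + j) ρ i

end RelaySelection

end

namespace RelaySelection

open scoped ENNReal

/-! Condition on the decoding set `S`. Its probability depends only on `S.card = l`
(`measure_decodingSet_eq`), which yields the binomial weights. Given `S`, a relay `k ∈ S` is in
outage only through its second hop. Ties are null, so the outage splits into `l` equiprobable events
"`k` has the largest estimate and its actual SNR is below `T`". Each has probability `∫ F(z₁)^(l-1)`
over `z₂ < T`, where `F` is the distribution function of the estimates (`measure_outage_inter`).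

The series over `j` comes from writing the bivariate law as a negative binomial mixture of products
of two equal gamma laws (`bivariateGammaMeasure_eq_sum`): in each component the integral factors
into a moment of `F` and a gamma distribution function at `T`. Expanding `F = 1 - Γ(m, ·)/Γ(m)`
binomially reduces the moment to auxiliary integrals. For integer `m`, `Γ(m, z)` is `e^(-z)` times a
polynomial, and the multinomial theorem evaluates these as `psi` (`auxIntegral_eq_psi`). Convergence
follows from finiteness of the law, since the mixture terms are nonnegative. -/

/-! ### Incomplete gamma function and the auxiliary integral. -/

/-- The product rule telescopes: each new summand cancels the previous derivative and leaves only
the top-degree term. -/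
lemma hasDerivAt_neg_exp_mul_expSum (n : ℕ) (t : ℝ) :
    HasDerivAt (fun t : ℝ => -(Real.exp (-t) * ∑ k ∈ Finset.range (n + 1), t ^ k / k.factorial))
      (t ^ n / n.factorial * Real.exp (-t)) t := by
  have he : HasDerivAt (fun t : ℝ => Real.exp (-t)) (-Real.exp (-t)) t := by
    simpa using (hasDerivAt_neg t).exp
  induction n with
  | zero => simpa using he.fun_neg
  | succ n ih =>
    have hp : HasDerivAt (fun t : ℝ => t ^ (n + 1) / ((n + 1).factorial : ℝ))
        (t ^ n / n.factorial) t := by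
      have h := (hasDerivAt_pow (n + 1) t).div_const ((n + 1).factorial : ℝ)
      refine h.congr_deriv ?_
      rw [Nat.factorial_succ]
      push_cast
      have : (n.factorial : ℝ) ≠ 0 := by positivity
      have : (n + 1 : ℝ) ≠ 0 := by positivity
      field_simp
    refine (ih.sub (he.mul hp)).congr_deriv ?_ |>.congr_of_eventuallyEq (.of_forall fun x => ?_)
    · ring
    · simp only [Finset.sum_range_succ _ (n + 1), Pi.sub_apply, Pi.mul_apply]
      ring

/-- The upper incomplete gamma function at a positive integer. -/
lemma upperGamma_nat {m : ℕ} (hm : 1 ≤ m) {z : ℝ} (hz : 0 ≤ z) :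
    upperGamma m z =
      Real.Gamma m * (Real.exp (-z) * ∑ k ∈ Finset.range m, z ^ k / k.factorial) := by
  obtain ⟨n, rfl⟩ : ∃ n, m = n + 1 := ⟨m - 1, by omega⟩
  have hlim : Filter.Tendsto
      (fun t : ℝ => -(Real.exp (-t) * ∑ k ∈ Finset.range (n + 1), t ^ k / k.factorial))
      Filter.atTop (nhds 0) := by
    have : Filter.Tendsto (fun t : ℝ => -∑ k ∈ Finset.range (n + 1),
        (t ^ k * Real.exp (-t)) * (k.factorial : ℝ)⁻¹) Filter.atTop
        (nhds (-∑ k ∈ Finset.range (n + 1), 0 * (k.factorial : ℝ)⁻¹)) :=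
      (tendsto_finsetSum _ fun k _ =>
        (Real.tendsto_pow_mul_exp_neg_atTop_nhds_zero k).mul_const _).neg
    simp only [zero_mul, Finset.sum_const_zero, neg_zero] at this
    refine this.congr fun t => ?_
    rw [Finset.mul_sum]
    congr 1
    exact Finset.sum_congr rfl fun k _ => by ring
  have h := integral_Ioi_of_hasDerivAt_of_nonneg' (a := z)
    (fun x _ => hasDerivAt_neg_exp_mul_expSum n x)
    (fun x hx => by
      have : 0 < x := hz.trans_lt hx
      positivity) hlim
  push_cast
  rw [Real.Gamma_nat_eq_factorial]
  calc upperGamma ((n : ℝ) + 1) z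
      = ∫ x in Set.Ioi z, (n.factorial : ℝ) * (x ^ n / n.factorial * Real.exp (-x)) := by
        unfold upperGamma
        refine setIntegral_congr_fun measurableSet_Ioi fun x _ => ?_
        have : (n.factorial : ℝ) ≠ 0 := by positivity
        simp only [add_sub_cancel_right, Real.rpow_natCast]
        field_simp
    _ = _ := by
        rw [integral_const_mul, h]
        ring

lemma integrableOn_pow_mul_exp_neg_mul (n : ℕ) {c : ℝ} (hc : 0 < c) :
    IntegrableOn (fun x : ℝ => x ^ n * Real.exp (-(c * x))) (Set.Ioi 0) := by
  have h := integrableOn_rpow_mul_exp_neg_mul_rpow (p := 1) (s := n) (b := c)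
    (by have : (0 : ℝ) ≤ n := n.cast_nonneg
        linarith) one_pos hc
  simpa using h

lemma integral_pow_mul_exp_neg_mul (n : ℕ) {c : ℝ} (hc : 0 < c) :
    ∫ x in Set.Ioi (0 : ℝ), x ^ n * Real.exp (-(c * x)) = n.factorial / c ^ (n + 1) := by
  have h := Real.integral_rpow_mul_exp_neg_mul_Ioi (a := n + 1) (r := c) (by positivity) hc
  rw [Real.Gamma_nat_eq_factorial] at h
  simp only [add_sub_cancel_right, Real.rpow_natCast] at h
  rw [h]
  have : (1 / c) ^ ((n : ℝ) + 1) = (1 / c) ^ (n + 1) := by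
    rw [← Real.rpow_natCast]
    push_cast
    rfl
  rw [this, one_div, inv_pow]
  ring

lemma multinomial_eq_div {ι : Type*} [DecidableEq ι] {s : Finset ι} {i : ℕ} {ξ : ι → ℕ}
    (hξ : ∑ k ∈ s, ξ k = i) :
    (Nat.multinomial s ξ : ℝ) = Real.Gamma (i + 1) / ∏ k ∈ s, Real.Gamma (ξ k + 1) := by
  have h := Nat.multinomial_spec s ξ
  rw [hξ] at h
  simp_rw [Real.Gamma_nat_eq_factorial]
  rw [eq_div_iff (by positivity), mul_comm]
  exact_mod_cast h

/-- Multinomial expansion of a power of the upper incomplete gamma function. -/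
lemma upperGamma_pow {m : ℕ} (hm : 1 ≤ m) {z : ℝ} (hz : 0 ≤ z) (i : ℕ) :
    upperGamma m z ^ i = ∑ ξ ∈ Finset.piAntidiag (Finset.univ : Finset (Fin m)) i,
      Real.Gamma m ^ i * (Real.Gamma (i + 1) *
        ∏ k : Fin m, (1 / (k : ℕ).factorial : ℝ) ^ ξ k / Real.Gamma (ξ k + 1)) *
        (z ^ (∑ q : Fin m, (q : ℕ) * ξ q) * Real.exp (-(i * z))) := by
  rw [upperGamma_nat hm hz, mul_pow, mul_pow, ← Fin.sum_univ_eq_sum_range (fun k => z ^ k / _) m,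
    Finset.sum_pow_eq_sum_piAntidiag, Finset.mul_sum, Finset.mul_sum]
  refine Finset.sum_congr rfl fun ξ hξ => ?_
  rw [Finset.mem_piAntidiag] at hξ
  rw [multinomial_eq_div hξ.1, ← Real.exp_nat_mul, ← Finset.prod_pow_eq_pow_sum,
    Finset.prod_div_distrib]
  have : ∏ k : Fin m, (z ^ (k : ℕ) / (k : ℕ).factorial) ^ ξ k =
      (∏ k : Fin m, (1 / (k : ℕ).factorial : ℝ) ^ ξ k) * ∏ k : Fin m, z ^ ((k : ℕ) * ξ k) := by
    rw [← Finset.prod_mul_distrib]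
    refine Finset.prod_congr rfl fun k _ => ?_
    rw [pow_mul, ← mul_pow]
    ring
  rw [this]
  ring_nf

lemma aux_integrand_expansion {m : ℕ} (hm : 1 ≤ m) (n i : ℕ) (α : ℝ) {β : ℝ} (hβ : 0 < β) {x : ℝ}
    (hx : 0 < x) :
    x ^ n * Real.exp (-(α * x)) * upperGamma m (β * x) ^ i =
      ∑ ξ ∈ Finset.piAntidiag (Finset.univ : Finset (Fin m)) i,
        (Real.Gamma m ^ i * (Real.Gamma (i + 1) *
          ∏ k : Fin m, (1 / (k : ℕ).factorial : ℝ) ^ ξ k / Real.Gamma (ξ k + 1)) *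
          β ^ (∑ q : Fin m, (q : ℕ) * ξ q)) *
        (x ^ (n + ∑ q : Fin m, (q : ℕ) * ξ q) * Real.exp (-((α + i * β) * x))) := by
  rw [upperGamma_pow hm (by positivity), Finset.mul_sum]
  refine Finset.sum_congr rfl fun ξ _ => ?_
  have : Real.exp (-((α + i * β) * x)) = Real.exp (-(α * x)) * Real.exp (-(i * (β * x))) := by
    rw [← Real.exp_add]
    ring_nf
  rw [this, pow_add, mul_pow]
  ring

lemma integrableOn_auxIntegral {m : ℕ} (hm : 1 ≤ m) (n i : ℕ) {α β : ℝ} (hα : 0 < α)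
    (hβ : 0 < β) :
    IntegrableOn (fun x => x ^ n * Real.exp (-(α * x)) * upperGamma m (β * x) ^ i)
      (Set.Ioi 0) := by
  refine IntegrableOn.congr_fun ?_
    (fun x hx => (aux_integrand_expansion hm n i α hβ hx).symm) measurableSet_Ioi
  exact integrable_finsetSum _ fun ξ _ =>
    (integrableOn_pow_mul_exp_neg_mul _ (by positivity)).const_mul _

lemma auxIntegral_eq_sum {m : ℕ} (hm : 1 ≤ m) (n i : ℕ) {α β : ℝ} (hα : 0 < α) (hβ : 0 < β) :
    auxIntegral n α m β i =
      ∑ ξ ∈ Finset.piAntidiag (Finset.univ : Finset (Fin m)) i,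
        (Real.Gamma m ^ i * (Real.Gamma (i + 1) *
          ∏ k : Fin m, (1 / (k : ℕ).factorial : ℝ) ^ ξ k / Real.Gamma (ξ k + 1)) *
          β ^ (∑ q : Fin m, (q : ℕ) * ξ q)) *
        ((n + ∑ q : Fin m, (q : ℕ) * ξ q).factorial /
          (α + i * β) ^ (n + ∑ q : Fin m, (q : ℕ) * ξ q + 1)) := by
  unfold auxIntegral
  rw [setIntegral_congr_fun measurableSet_Ioi
      (fun x hx => aux_integrand_expansion hm n i α hβ hx), integral_finsetSum]
  · refine Finset.sum_congr rfl fun ξ _ => ?_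
    rw [integral_const_mul, integral_pow_mul_exp_neg_mul _ (by positivity)]
  · exact fun ξ _ => (integrableOn_pow_mul_exp_neg_mul _ (by positivity)).const_mul _

/-- The closed form of the auxiliary integral in terms of `psi`. -/
lemma auxIntegral_eq_psi {m : ℕ} (hm : 1 ≤ m) {g ρ : ℝ} (hg : 0 < g) (hρ : ρ < 1) (j i : ℕ) :
    auxIntegral (m + j - 1) (m / (g * (1 - ρ))) m (m / g) i =
      Real.Gamma m ^ i * (g / m) ^ (m + j) * psi m (m + j) ρ i := by
  have h1 : 0 < 1 - ρ := sub_pos.2 hρ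
  have hm0 : (0 : ℝ) < m := by exact_mod_cast hm
  rw [auxIntegral_eq_sum hm _ _ (by positivity) (by positivity), psi, Finset.mul_sum,
    Finset.mul_sum]
  refine Finset.sum_congr rfl fun ξ _ => ?_
  set s := ∑ q : Fin m, (q : ℕ) * ξ q with hs
  have hc : 0 < 1 / (1 - ρ) + (i : ℝ) := by positivity
  set c := 1 / (1 - ρ) + (i : ℝ)
  -- Pulling `m / g` out of the total rate leaves exactly the base `c` that occurs in `psi`.
  have hαβ : (m : ℝ) / (g * (1 - ρ)) + i * (m / g) = m / g * c := by
    simp only [c]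
    field_simp
  have hexp : m + j - 1 + s + 1 = s + (m + j) := by omega
  have hprod : ∏ k : Fin m, (1 / ((k : ℕ).factorial * c ^ (k : ℕ))) ^ ξ k / Real.Gamma (ξ k + 1) =
      (∏ k : Fin m, (1 / (k : ℕ).factorial : ℝ) ^ ξ k / Real.Gamma (ξ k + 1)) / c ^ s := by
    rw [hs, ← Finset.prod_pow_eq_pow_sum, ← Finset.prod_div_distrib]
    refine Finset.prod_congr rfl fun k _ => ?_
    rw [pow_mul, div_pow, div_pow, mul_pow]
    field_simp
  rw [hαβ, hexp, hprod, mul_pow, pow_add, pow_add c]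
  have : (g / m : ℝ) ^ (m + j) = ((m / g : ℝ) ^ (m + j))⁻¹ := by rw [← inv_pow, inv_div]
  rw [this]
  have : (m / g : ℝ) ≠ 0 := by positivity
  field_simp

/-! ### The bivariate gamma law as a mixture. -/

lemma measurable_gammaPDF (a r : ℝ) : Measurable (gammaPDF a r) :=
  (measurable_gammaPDFReal a r).ennreal_ofReal

/-- The weights (of a negative binomial law) in the mixture representation of the bivariate
gamma law. -/
noncomputable def mixtureWeight (m : ℕ) (ρ : ℝ) (j : ℕ) : ℝ :=
  (1 - ρ) ^ m * ρ ^ j * Real.Gamma ((m : ℝ) + j) / (j.factorial * Real.Gamma m)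

lemma mixtureWeight_nonneg {m : ℕ} (hm : 1 ≤ m) {ρ : ℝ} (hρ0 : 0 ≤ ρ) (hρ1 : ρ < 1) (j : ℕ) :
    0 ≤ mixtureWeight m ρ j := by
  have h1 : 0 < 1 - ρ := sub_pos.2 hρ1
  have hm0 : (0 : ℝ) < m := by exact_mod_cast hm
  have := Real.Gamma_pos_of_pos hm0
  have : 0 < Real.Gamma ((m : ℝ) + j) := Real.Gamma_pos_of_pos (by positivity)
  unfold mixtureWeight
  positivity

lemma gammaPDFReal_natCast_add {m : ℕ} (hm : 1 ≤ m) (j : ℕ) (r : ℝ) {x : ℝ} (hx : 0 < x) :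
    gammaPDFReal ((m : ℝ) + j) r x =
      r ^ (m + j) / Real.Gamma ((m : ℝ) + j) * x ^ (m + j - 1) * Real.exp (-(r * x)) := by
  have h1 : ((m : ℝ) + j) = ((m + j : ℕ) : ℝ) := by push_cast; rfl
  have h2 : ((m + j : ℕ) : ℝ) - 1 = ((m + j - 1 : ℕ) : ℝ) := by
    rw [Nat.cast_sub (by omega)]
    simp
  rw [gammaPDFReal, if_pos hx.le, h1, h2, Real.rpow_natCast, Real.rpow_natCast]

lemma ascPochhammer_eval_mul_Gamma {m : ℕ} (hm : 1 ≤ m) (j : ℕ) :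
    (ascPochhammer ℝ j).eval (m : ℝ) * Real.Gamma m = Real.Gamma ((m : ℝ) + j) := by
  induction j with
  | zero => simp
  | succ j ih =>
    have hne : (m : ℝ) + j ≠ 0 := by positivity
    push_cast
    rw [ascPochhammer_succ_eval, ← add_assoc, Real.Gamma_add_one hne, ← ih]
    ring

/-- The Pochhammer symbol is `Γ(m+j)/Γ(m)`. Normalising two gamma densities absorbs
`(1-ρ)^(-2(m+j))`, so `(1-ρ)^m` is left in the weight. -/
lemma bivariate_term_eq {m : ℕ} (hm : 1 ≤ m) {g ρ : ℝ} (hg : 0 < g) (hρ1 : ρ < 1)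
    {x y : ℝ} (hx : 0 < x) (hy : 0 < y) (j : ℕ) :
    ((ascPochhammer ℝ j).eval (m : ℝ) * (m : ℝ) ^ (2 * m + 2 * j) * ρ ^ j /
          ((Nat.factorial j : ℝ) * (1 - ρ) ^ (m + 2 * j))) *
        ((x ^ (m + j - 1) * Real.exp (-(m * x / ((1 - ρ) * g))) /
            (Real.Gamma ((m : ℝ) + j) * g ^ (m + j))) *
          (y ^ (m + j - 1) * Real.exp (-(m * y / ((1 - ρ) * g))) /
            (Real.Gamma ((m : ℝ) + j) * g ^ (m + j)))) =
      mixtureWeight m ρ j * (gammaPDFReal ((m : ℝ) + j) (m / ((1 - ρ) * g)) x *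
        gammaPDFReal ((m : ℝ) + j) (m / ((1 - ρ) * g)) y) := by
  have h1 : 0 < 1 - ρ := sub_pos.2 hρ1
  have hm0 : (0 : ℝ) < m := by exact_mod_cast hm
  have hG := Real.Gamma_pos_of_pos hm0
  have hGj : 0 < Real.Gamma ((m : ℝ) + j) := Real.Gamma_pos_of_pos (by positivity)
  rw [gammaPDFReal_natCast_add hm _ _ hx, gammaPDFReal_natCast_add hm _ _ hy, mixtureWeight,
    ← ascPochhammer_eval_mul_Gamma hm, div_mul_eq_mul_div, div_mul_eq_mul_div]
  rw [← ascPochhammer_eval_mul_Gamma hm] at hGj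
  set p := (ascPochhammer ℝ j).eval (m : ℝ)
  have hp : 0 < p := pos_of_mul_pos_left hGj hG.le
  rw [div_pow, mul_pow (1 - ρ) g]
  have e : (1 - ρ) ^ (m + 2 * j) * (1 - ρ) ^ m = (1 - ρ) ^ (m + j) * (1 - ρ) ^ (m + j) := by
    rw [← pow_add, ← pow_add]
    congr 1
    omega
  have e2 : (m : ℝ) ^ (2 * m + 2 * j) = (m : ℝ) ^ (m + j) * (m : ℝ) ^ (m + j) := by
    rw [← pow_add]
    congr 1
    omega
  have e3 : (1 - ρ) ^ m = (1 - ρ) ^ (m + j) * (1 - ρ) ^ (m + j) / (1 - ρ) ^ (m + 2 * j) := by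
    rw [← e]
    field_simp
  rw [e2, e3]
  generalize (1 - ρ) ^ (m + 2 * j) = A at *
  field_simp

/-- Bounding `1/Γ(m+j)` by `1` leaves an exponential series. Summability is needed to pass from the
real series defining the density to an extended nonnegative one. -/
lemma summable_mixture {m : ℕ} (hm : 1 ≤ m) {g ρ : ℝ} (hg : 0 < g) (hρ0 : 0 ≤ ρ) (hρ1 : ρ < 1)
    {x y : ℝ} (hx : 0 < x) (hy : 0 < y) :
    Summable fun j : ℕ => mixtureWeight m ρ j *
      (gammaPDFReal ((m : ℝ) + j) (m / ((1 - ρ) * g)) x *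
        gammaPDFReal ((m : ℝ) + j) (m / ((1 - ρ) * g)) y) := by
  have h1 : 0 < 1 - ρ := sub_pos.2 hρ1
  have hm0 : (0 : ℝ) < m := by exact_mod_cast hm
  have hG := Real.Gamma_pos_of_pos hm0
  set α := (m : ℝ) / ((1 - ρ) * g) with hα
  have hα0 : 0 < α := by positivity
  set C := (1 - ρ) ^ m / Real.Gamma m * (α ^ m * x ^ (m - 1) * Real.exp (-(α * x))) *
    (α ^ m * y ^ (m - 1) * Real.exp (-(α * y))) with hC
  refine Summable.of_nonneg_of_le (fun j => ?_) (fun j => ?_)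
    ((Real.summable_pow_div_factorial (ρ * (α * x) * (α * y))).mul_left C)
  · have := mixtureWeight_nonneg hm hρ0 hρ1 j
    have hj : (0 : ℝ) < m + j := by positivity
    have := gammaPDFReal_nonneg hj hα0 x
    have := gammaPDFReal_nonneg hj hα0 y
    positivity
  · rw [gammaPDFReal_natCast_add hm _ _ hx, gammaPDFReal_natCast_add hm _ _ hy, mixtureWeight]
    have hGj : 1 ≤ Real.Gamma ((m : ℝ) + j) := by
      have : (m : ℝ) + j = ((m + j - 1 : ℕ) : ℝ) + 1 := by
        rw [Nat.cast_sub (by omega)]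
        push_cast
        ring
      rw [this, Real.Gamma_nat_eq_factorial]
      exact_mod_cast Nat.succ_le_of_lt (Nat.factorial_pos _)
    have hx' : x ^ (m + j - 1) = x ^ (m - 1) * x ^ j := by
      rw [← pow_add]
      congr 1
      omega
    have hy' : y ^ (m + j - 1) = y ^ (m - 1) * y ^ j := by
      rw [← pow_add]
      congr 1
      omega
    calc _ = C * ((ρ * (α * x) * (α * y)) ^ j / j.factorial) / Real.Gamma ((m : ℝ) + j) := by
          rw [hC, hx', hy', mul_pow, mul_pow, mul_pow, mul_pow, pow_add]
          field_simp
      _ ≤ _ := div_le_self (by positivity) hGj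

/-- The bivariate gamma law is a mixture of products of gamma laws. -/
lemma bivariateGammaMeasure_eq_sum {m : ℕ} (hm : 1 ≤ m) {g ρ : ℝ} (hg : 0 < g) (hρ0 : 0 ≤ ρ)
    (hρ1 : ρ < 1) :
    bivariateGammaMeasure m g ρ = Measure.sum fun j : ℕ =>
      ENNReal.ofReal (mixtureWeight m ρ j) •
        (gammaMeasure ((m : ℝ) + j) (m / ((1 - ρ) * g))).prod
          (gammaMeasure ((m : ℝ) + j) (m / ((1 - ρ) * g))) := by
  have h1 : 0 < 1 - ρ := sub_pos.2 hρ1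
  have hm0 : (0 : ℝ) < m := by exact_mod_cast hm
  set α := (m : ℝ) / ((1 - ρ) * g) with hα
  have hα0 : 0 < α := by positivity
  have hmeas (j : ℕ) : Measurable fun z : ℝ × ℝ =>
      gammaPDF ((m : ℝ) + j) α z.1 * gammaPDF ((m : ℝ) + j) α z.2 :=
    ((measurable_gammaPDF _ _).comp measurable_fst).mul
      ((measurable_gammaPDF _ _).comp measurable_snd)
  have hterm (j : ℕ) : ENNReal.ofReal (mixtureWeight m ρ j) •
      (gammaMeasure ((m : ℝ) + j) α).prod (gammaMeasure ((m : ℝ) + j) α) =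
      (volume : Measure (ℝ × ℝ)).withDensity (ENNReal.ofReal (mixtureWeight m ρ j) •
        fun z => gammaPDF ((m : ℝ) + j) α z.1 * gammaPDF ((m : ℝ) + j) α z.2) := by
    rw [withDensity_smul _ (hmeas j), Measure.volume_eq_prod, gammaMeasure,
      prod_withDensity (measurable_gammaPDF _ _) (measurable_gammaPDF _ _)]
  simp_rw [hterm]
  rw [← withDensity_tsum fun j => (hmeas j).const_smul _, bivariateGammaMeasure]
  refine withDensity_congr_ae ?_
  -- The axes are discarded because `gammaPDFReal` can be nonzero at `0` (when `m = 1`), whereas the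
  -- bivariate density vanishes there.
  have hne1 : ∀ᵐ z : ℝ × ℝ, z.1 ≠ 0 := by
    rw [Measure.volume_eq_prod]
    exact Measure.quasiMeasurePreserving_fst.ae (p := fun x : ℝ => x ≠ 0) (by simp [ae_iff])
  have hne2 : ∀ᵐ z : ℝ × ℝ, z.2 ≠ 0 := by
    rw [Measure.volume_eq_prod]
    exact Measure.quasiMeasurePreserving_snd.ae (p := fun x : ℝ => x ≠ 0) (by simp [ae_iff])
  filter_upwards [hne1, hne2] with z hz1 hz2
  simp only [ENNReal.tsum_apply, Pi.smul_apply, smul_eq_mul]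
  by_cases hz : 0 < z.1 ∧ 0 < z.2
  · rw [bivariateGammaPDF, if_pos hz]
    simp_rw [bivariate_term_eq hm hg hρ1 hz.1 hz.2]
    have hnn (j : ℕ) (x : ℝ) : 0 ≤ gammaPDFReal ((m : ℝ) + j) α x :=
      gammaPDFReal_nonneg (by positivity) hα0 x
    rw [ENNReal.ofReal_tsum_of_nonneg
      (fun j => mul_nonneg (mixtureWeight_nonneg hm hρ0 hρ1 j) (mul_nonneg (hnn j _) (hnn j _)))
      (summable_mixture hm hg hρ0 hρ1 hz.1 hz.2)]
    refine tsum_congr fun j => ?_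
    rw [ENNReal.ofReal_mul (mixtureWeight_nonneg hm hρ0 hρ1 j), ENNReal.ofReal_mul (hnn j _)]
    rfl
  · rw [bivariateGammaPDF, if_neg hz, ENNReal.ofReal_zero]
    symm
    rw [ENNReal.tsum_eq_zero]
    intro j
    rcases not_and_or.1 hz with h | h
    · rw [gammaPDF_of_neg (lt_of_le_of_ne (not_lt.1 h) hz1)]
      simp
    · rw [gammaPDF_of_neg (x := z.2) (lt_of_le_of_ne (not_lt.1 h) hz2)]
      simp

/-- The first marginal of the bivariate gamma law is a gamma law. -/
lemma map_fst_bivariateGammaMeasure {m : ℕ} (hm : 1 ≤ m) {g ρ : ℝ} (hg : 0 < g) (hρ0 : 0 ≤ ρ)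
    (hρ1 : ρ < 1) :
    (bivariateGammaMeasure m g ρ).map Prod.fst = gammaMeasure m (m / g) := by
  have h1 : 0 < 1 - ρ := sub_pos.2 hρ1
  have hm0 : (0 : ℝ) < m := by exact_mod_cast hm
  have hG := Real.Gamma_pos_of_pos hm0
  rw [bivariateGammaMeasure_eq_sum hm hg hρ0 hρ1, Measure.map_sum measurable_fst.aemeasurable]
  set α := (m : ℝ) / ((1 - ρ) * g) with hα
  have hα0 : 0 < α := by positivity
  have hterm (j : ℕ) : Measure.map Prod.fst (ENNReal.ofReal (mixtureWeight m ρ j) •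
      (gammaMeasure ((m : ℝ) + j) α).prod (gammaMeasure ((m : ℝ) + j) α)) =
      volume.withDensity (ENNReal.ofReal (mixtureWeight m ρ j) • gammaPDF ((m : ℝ) + j) α) := by
    have : IsProbabilityMeasure (gammaMeasure ((m : ℝ) + j) α) :=
      isProbabilityMeasure_gammaMeasure (by positivity) hα0
    rw [Measure.map_smul, Measure.map_fst_prod, withDensity_smul _ (measurable_gammaPDF _ _),
      measure_univ, one_smul, gammaMeasure]
  simp_rw [hterm]
  rw [← withDensity_tsum fun j => (measurable_gammaPDF _ _).const_smul _, gammaMeasure]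
  refine withDensity_congr_ae ?_
  have hne : ∀ᵐ x : ℝ, x ≠ 0 := by simp [ae_iff]
  filter_upwards [hne] with x hx0
  simp only [ENNReal.tsum_apply, Pi.smul_apply, smul_eq_mul]
  rcases lt_or_gt_of_ne hx0 with hx | hx
  · simp [gammaPDF_of_neg hx]
  have hw (j : ℕ) : mixtureWeight m ρ j * gammaPDFReal ((m : ℝ) + j) α x =
      (1 - ρ) ^ m * α ^ m / Real.Gamma m * x ^ (m - 1) * Real.exp (-(α * x)) *
        ((ρ * (α * x)) ^ j / j.factorial) := by
    have hGj : 0 < Real.Gamma ((m : ℝ) + j) := Real.Gamma_pos_of_pos (by positivity)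
    have hx' : x ^ (m + j - 1) = x ^ (m - 1) * x ^ j := by
      rw [← pow_add]
      congr 1
      omega
    rw [gammaPDFReal_natCast_add hm _ _ hx, mixtureWeight, hx', mul_pow, mul_pow, pow_add]
    field_simp
  have hnn (j : ℕ) : 0 ≤ mixtureWeight m ρ j * gammaPDFReal ((m : ℝ) + j) α x :=
    mul_nonneg (mixtureWeight_nonneg hm hρ0 hρ1 j) (gammaPDFReal_nonneg (by positivity) hα0 x)
  -- The series in `j` is that of `e^(ραx)`, which lowers the rate from `α` to `(1-ρ)α = m/g`.
  have hsum : HasSum (fun j : ℕ => mixtureWeight m ρ j * gammaPDFReal ((m : ℝ) + j) α x)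
      (gammaPDFReal m (m / g) x) := by
    simp_rw [hw]
    have he : HasSum (fun j : ℕ => (ρ * (α * x)) ^ j / j.factorial)
        (Real.exp (ρ * (α * x))) := by
      rw [Real.exp_eq_exp_ℝ]
      exact NormedSpace.expSeries_div_hasSum_exp _
    have h0 := gammaPDFReal_natCast_add hm 0 (m / g) hx
    simp only [Nat.cast_zero, add_zero] at h0
    have hβ : (m : ℝ) / g = (1 - ρ) * α := by
      rw [hα]
      field_simp
    have hval : gammaPDFReal m (m / g) x = (1 - ρ) ^ m * α ^ m / Real.Gamma m * x ^ (m - 1) *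
        Real.exp (-(α * x)) * Real.exp (ρ * (α * x)) := by
      rw [h0, mul_assoc _ (Real.exp _) (Real.exp _), ← Real.exp_add, hβ, mul_pow]
      ring_nf
    rw [hval]
    exact he.mul_left _
  calc _ = ∑' j : ℕ, ENNReal.ofReal (mixtureWeight m ρ j * gammaPDFReal ((m : ℝ) + j) α x) :=
        tsum_congr fun j => by rw [ENNReal.ofReal_mul (mixtureWeight_nonneg hm hρ0 hρ1 j)]; rfl
    _ = _ := by
        rw [← ENNReal.ofReal_tsum_of_nonneg hnn hsum.summable, hsum.tsum_eq]
        rfl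

/-! ### Gamma tails and moments of distribution functions. -/

/-- Tails of gamma laws in terms of the upper incomplete gamma function. -/
lemma gammaMeasure_real_Ioi {a r t : ℝ} (ha : 0 < a) (hr : 0 < r) (ht : 0 ≤ t) :
    (gammaMeasure a r).real (Set.Ioi t) = upperGamma a (r * t) / Real.Gamma a := by
  have hG := Real.Gamma_pos_of_pos ha
  have hnn : ∀ x, 0 ≤ gammaPDFReal a r x := gammaPDFReal_nonneg ha hr
  rw [measureReal_def, gammaMeasure, withDensity_apply _ measurableSet_Ioi]
  unfold gammaPDF
  rw [← integral_eq_lintegral_of_nonneg_ae (.of_forall hnn)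
    (stronglyMeasurable_gammaPDFReal a r).aestronglyMeasurable]
  have h := integral_comp_mul_left_Ioi (fun u : ℝ => u ^ (a - 1) * Real.exp (-u)) t hr
  rw [upperGamma, ← mul_right_inj' (inv_ne_zero hr.ne'), ← mul_div_assoc, ← smul_eq_mul (r⁻¹) (∫ _ in _, _),
    ← smul_eq_mul (r⁻¹) (∫ _ in _, _), ← h, smul_eq_mul, ← integral_const_mul, ← integral_div]
  refine setIntegral_congr_fun measurableSet_Ioi fun x hx => ?_
  have hx0 : 0 < x := ht.trans_lt hx
  simp only [gammaPDFReal, if_pos hx0.le]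
  rw [Real.mul_rpow hr.le hx0.le, Real.rpow_sub_one hr.ne']
  field_simp

lemma gammaMeasure_real_Iic {a r t : ℝ} (ha : 0 < a) (hr : 0 < r) (ht : 0 ≤ t) :
    (gammaMeasure a r).real (Set.Iic t) = 1 - upperGamma a (r * t) / Real.Gamma a := by
  have := isProbabilityMeasure_gammaMeasure ha hr
  rw [← gammaMeasure_real_Ioi ha hr ht, ← Set.compl_Ioi, probReal_compl_eq_one_sub measurableSet_Ioi]

/-- Absolute continuity excludes atoms; this rules out ties and identifies `<` with `≤` at the
threshold. -/
instance nullSingletonClass_gammaMeasure (a r : ℝ) : NullSingletonClass (gammaMeasure a r) := by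
  unfold gammaMeasure
  infer_instance

lemma gammaMeasure_real_Iio {a r t : ℝ} (ha : 0 < a) (hr : 0 < r) (ht : 0 ≤ t) :
    (gammaMeasure a r).real (Set.Iio t) = 1 - upperGamma a (r * t) / Real.Gamma a := by
  rw [← gammaMeasure_real_Iic ha hr ht]
  exact measureReal_congr Iio_ae_eq_Iic

lemma measurable_measure_Iic (ν : Measure ℝ) : Measurable fun x => ν (Set.Iic x) :=
  Monotone.measurable fun _ _ h => measure_mono (Set.Iic_subset_Iic.2 h)

/-- The moments of the distribution function of one gamma law under another gamma law. -/
lemma toReal_lintegral_gammaMeasure_Iic_pow {m : ℕ} (hm : 1 ≤ m) {g ρ : ℝ} (hg : 0 < g)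
    (hρ1 : ρ < 1) (j n : ℕ) :
    (∫⁻ x, gammaMeasure m (m / g) (Set.Iic x) ^ n
      ∂gammaMeasure ((m : ℝ) + j) (m / ((1 - ρ) * g))).toReal =
    ∑ i ∈ Finset.range (n + 1), (-1) ^ i * (n.choose i : ℝ) * psi m (m + j) ρ i /
      ((1 - ρ) ^ (m + j) * Real.Gamma ((m : ℝ) + j)) := by
  have h1 : 0 < 1 - ρ := sub_pos.2 hρ1
  have hm0 : (0 : ℝ) < m := by exact_mod_cast hm
  have hG := Real.Gamma_pos_of_pos hm0
  have hGj : 0 < Real.Gamma ((m : ℝ) + j) := Real.Gamma_pos_of_pos (by positivity)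
  have hβ0 : (0 : ℝ) < m / g := by positivity
  have hα' : (m : ℝ) / ((1 - ρ) * g) = m / (g * (1 - ρ)) := by rw [mul_comm g]
  have hprob := isProbabilityMeasure_gammaMeasure hm0 hβ0
  rw [hα']
  set α := (m : ℝ) / (g * (1 - ρ)) with hα
  have hα0 : 0 < α := by positivity
  set ν := gammaMeasure (m : ℝ) (m / g) with hν
  have hmeas : Measurable fun x => ν (Set.Iic x) ^ n := (measurable_measure_Iic ν).pow_const n
  have hpdf : ∀ x, 0 ≤ gammaPDFReal ((m : ℝ) + j) α x :=
    gammaPDFReal_nonneg (by positivity) hα0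
  rw [gammaMeasure, lintegral_withDensity_eq_lintegral_mul _ (measurable_gammaPDF _ _) hmeas]
  -- A real integral is required because the binomial expansion below has alternating signs.
  have hofReal (x : ℝ) : (gammaPDF ((m : ℝ) + j) α * fun x => ν (Set.Iic x) ^ n) x =
      ENNReal.ofReal (gammaPDFReal ((m : ℝ) + j) α x * ν.real (Set.Iic x) ^ n) := by
    rw [ENNReal.ofReal_mul (hpdf x), ENNReal.ofReal_pow measureReal_nonneg, ofReal_measureReal]
    rfl
  simp_rw [hofReal]
  rw [← integral_eq_lintegral_of_nonneg_ae
    (.of_forall fun x => mul_nonneg (hpdf x) (pow_nonneg measureReal_nonneg n))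
    ((measurable_gammaPDFReal _ _).mul
      ((measurable_measure_Iic ν).ennreal_toReal.pow_const n)).aestronglyMeasurable]
  have hIci : ∫ x, gammaPDFReal ((m : ℝ) + j) α x * ν.real (Set.Iic x) ^ n =
      ∫ x in Set.Ioi 0, gammaPDFReal ((m : ℝ) + j) α x * ν.real (Set.Iic x) ^ n := by
    rw [← integral_Ici_eq_integral_Ioi, setIntegral_eq_integral_of_forall_compl_eq_zero]
    intro x hx
    rw [gammaPDFReal, if_neg (by simpa using hx), zero_mul]
  rw [hIci]
  have hexp (x : ℝ) (hx : x ∈ Set.Ioi (0 : ℝ)) :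
      gammaPDFReal ((m : ℝ) + j) α x * ν.real (Set.Iic x) ^ n =
      ∑ i ∈ Finset.range (n + 1), α ^ (m + j) / Real.Gamma ((m : ℝ) + j) *
        ((-1) ^ i * (n.choose i : ℝ) / Real.Gamma m ^ i) *
        (x ^ (m + j - 1) * Real.exp (-(α * x)) * upperGamma m (m / g * x) ^ i) := by
    rw [hν, gammaMeasure_real_Iic hm0 hβ0 (le_of_lt hx), gammaPDFReal_natCast_add hm _ _ hx,
      sub_eq_neg_add, add_pow, Finset.mul_sum]
    refine Finset.sum_congr rfl fun i _ => ?_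
    rw [one_pow, neg_pow, div_pow]
    ring
  rw [setIntegral_congr_fun measurableSet_Ioi hexp, integral_finsetSum _ fun i _ =>
    (integrableOn_auxIntegral hm _ _ hα0 hβ0).const_mul _]
  refine Finset.sum_congr rfl fun i _ => ?_
  have haux := auxIntegral_eq_psi hm hg hρ1 j i
  rw [auxIntegral] at haux
  rw [integral_const_mul, haux, hα, div_pow, div_pow, mul_pow]
  field_simp

/-- The integral of a function of the first coordinate over a half-plane for the bivariate gamma
law. -/
lemma lintegral_bivariateGammaMeasure {m : ℕ} (hm : 1 ≤ m) {g ρ : ℝ} (hg : 0 < g) (hρ0 : 0 ≤ ρ)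
    (hρ1 : ρ < 1) (T : ℝ) {f : ℝ → ℝ≥0∞} (hf : Measurable f) :
    ∫⁻ z in {z : ℝ × ℝ | z.2 < T}, f z.1 ∂bivariateGammaMeasure m g ρ =
      ∑' j : ℕ, ENNReal.ofReal (mixtureWeight m ρ j) *
        ((∫⁻ x, f x ∂gammaMeasure ((m : ℝ) + j) (m / ((1 - ρ) * g))) *
          gammaMeasure ((m : ℝ) + j) (m / ((1 - ρ) * g)) (Set.Iio T)) := by
  have h1 : 0 < 1 - ρ := sub_pos.2 hρ1
  have hm0 : (0 : ℝ) < m := by exact_mod_cast hm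
  set α := (m : ℝ) / ((1 - ρ) * g) with hα
  have hα0 : 0 < α := by positivity
  have hset : MeasurableSet {z : ℝ × ℝ | z.2 < T} := measurableSet_lt measurable_snd measurable_const
  rw [bivariateGammaMeasure_eq_sum hm hg hρ0 hρ1, ← lintegral_indicator hset, lintegral_sum_measure]
  refine tsum_congr fun j => ?_
  have : IsProbabilityMeasure (gammaMeasure ((m : ℝ) + j) α) :=
    isProbabilityMeasure_gammaMeasure (by positivity) hα0
  have hind : ({z : ℝ × ℝ | z.2 < T}.indicator fun z => f z.1) =
      fun z => f z.1 * (Set.Iio T).indicator 1 z.2 := by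
    ext z
    by_cases hz : z.2 < T <;> simp [Set.indicator, hz]
  rw [lintegral_smul_measure, smul_eq_mul, hind, lintegral_prod_mul hf.aemeasurable
    ((measurable_one.indicator measurableSet_Iio).aemeasurable),
    lintegral_indicator_one measurableSet_Iio]

/-! ### The series for the selection probability. -/

/-- The `j`-th term of the series for the probability that, among `n + 1` decoding relays, a given
relay has the largest estimated SNR and is in outage. -/
noncomputable def selectionTerm (m : ℕ) (g ρ T : ℝ) (n j : ℕ) : ℝ :=
  mixtureWeight m ρ j *
    ((∫⁻ x, gammaMeasure m (m / g) (Set.Iic x) ^ n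
        ∂gammaMeasure ((m : ℝ) + j) (m / ((1 - ρ) * g))).toReal *
      (gammaMeasure ((m : ℝ) + j) (m / ((1 - ρ) * g))).real (Set.Iio T))

/-- The weight's `(1-ρ)^m` turns the moment's `(1-ρ)^(m+j)` into `(1-ρ)^j`, and its `Γ(m+j)` cancels
that of the moment; the one left over comes from the distribution function at `T`. -/
lemma outageTerm_eq_sum_selectionTerm {N m : ℕ} (hm : 1 ≤ m) {g ρ T : ℝ} (hg : 0 < g)
    (hρ1 : ρ < 1) (hT : 0 < T) (j : ℕ) :
    outageTerm N m g ρ T j = ∑ l ∈ Finset.Icc 1 N,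
      (l : ℝ) * (N.choose l : ℝ) * (1 - upperGamma m (m / g * T) / Real.Gamma m) ^ (N - l) *
      (upperGamma m (m / g * T) / Real.Gamma m) ^ l * selectionTerm m g ρ T (l - 1) j := by
  have h1 : 0 < 1 - ρ := sub_pos.2 hρ1
  have hm0 : (0 : ℝ) < m := by exact_mod_cast hm
  have hG := Real.Gamma_pos_of_pos hm0
  have hGj : 0 < Real.Gamma ((m : ℝ) + j) := Real.Gamma_pos_of_pos (by positivity)
  refine Finset.sum_congr rfl fun l hl => ?_
  have hl1 : 1 ≤ l := (Finset.mem_Icc.1 hl).1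
  rw [selectionTerm, toReal_lintegral_gammaMeasure_Iic_pow hm hg hρ1,
    gammaMeasure_real_Iio (by positivity) (by positivity) hT.le, Nat.sub_add_cancel hl1,
    mixtureWeight, Finset.sum_mul, Finset.mul_sum, Finset.mul_sum]
  refine Finset.sum_congr rfl fun i _ => ?_
  have : (m : ℝ) / ((1 - ρ) * g) * T = m * T / ((1 - ρ) * g) := by ring
  rw [this, pow_add (1 - ρ)]
  generalize upperGamma ((m : ℝ) + j) _ = A
  generalize upperGamma (m : ℝ) _ / Real.Gamma m = B
  field_simp

/-- The integrand is at most `1` and the law is finite, so the extended nonnegative series has a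
finite sum and passes to the reals. -/
lemma hasSum_selectionTerm {m : ℕ} (hm : 1 ≤ m) {g ρ : ℝ} (hg : 0 < g) (hρ0 : 0 ≤ ρ)
    (hρ1 : ρ < 1) (T : ℝ) [IsFiniteMeasure (bivariateGammaMeasure m g ρ)] (n : ℕ) :
    HasSum (selectionTerm m g ρ T n)
      (∫⁻ z in {z : ℝ × ℝ | z.2 < T}, gammaMeasure m (m / g) (Set.Iic z.1) ^ n
        ∂bivariateGammaMeasure m g ρ).toReal := by
  have hm0 : (0 : ℝ) < m := by exact_mod_cast hm
  have := isProbabilityMeasure_gammaMeasure hm0 (div_pos hm0 hg)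
  have hfin : ∫⁻ z in {z : ℝ × ℝ | z.2 < T}, gammaMeasure m (m / g) (Set.Iic z.1) ^ n
      ∂bivariateGammaMeasure m g ρ ≠ ∞ := by
    refine ne_top_of_le_ne_top (measure_ne_top ((bivariateGammaMeasure m g ρ).restrict
      {z : ℝ × ℝ | z.2 < T}) Set.univ) ?_
    rw [← lintegral_one]
    exact lintegral_mono fun z => pow_le_one₀ zero_le prob_le_one
  have hmeas : Measurable fun x => gammaMeasure m (m / g) (Set.Iic x) ^ n :=
    (measurable_measure_Iic _).pow_const n
  rw [lintegral_bivariateGammaMeasure hm hg hρ0 hρ1 T hmeas] at hfin ⊢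
  have h := ENNReal.hasSum_toReal hfin
  rw [← ENNReal.tsum_toReal_eq (ENNReal.ne_top_of_tsum_ne_top hfin)] at h
  convert h using 1
  ext j
  rw [selectionTerm, ENNReal.toReal_mul, ENNReal.toReal_mul,
    ENNReal.toReal_ofReal (mixtureWeight_nonneg hm hρ0 hρ1 j), measureReal_def]

/-! ### Independence, relay selection and the outage event. -/

section Probability

variable {Ω : Type*} {N : ℕ}

/-- Among independent pairs with a common law, the probability that the pair `k` has the largest
first coordinate compared with the pairs in `s` and its second coordinate lies below `T`. -/
lemma measure_max_fst_and_snd_lt [MeasurableSpace Ω] {P : Measure Ω} [IsProbabilityMeasure P]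
    {Z : Fin N → Ω → ℝ × ℝ} (hZ : ∀ i, Measurable (Z i))
    {μ : Measure (ℝ × ℝ)} (hlaw : ∀ i, P.map (Z i) = μ) (hind : iIndepFun Z P)
    {k : Fin N} {s : Finset (Fin N)} (hk : k ∉ s) (T : ℝ) :
    P {ω | (∀ i ∈ s, (Z i ω).1 ≤ (Z k ω).1) ∧ (Z k ω).2 < T} =
      ∫⁻ z in {z : ℝ × ℝ | z.2 < T}, μ.map Prod.fst (Set.Iic z.1) ^ s.card ∂μ := by
  -- Bundling the competitors of `k` into one vector makes the joint law a product of two measures;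
  -- Fubini then fixes the value of `Z k`.
  set W : Ω → s → ℝ × ℝ := fun ω i => Z i ω with hW
  have hWm : Measurable W := measurable_pi_lambda _ fun i => hZ i
  have hkW : IndepFun (Z k) W P := by
    have h := hind.indepFun_finset {k} s (Finset.disjoint_singleton_left.2 hk) hZ
    have hev : Measurable fun v : ({k} : Finset (Fin N)) → ℝ × ℝ =>
        v ⟨k, Finset.mem_singleton_self k⟩ := measurable_pi_apply _
    exact h.comp hev measurable_id
  have hprod := (indepFun_iff_map_prod_eq_prod_map_map (hZ k).aemeasurable hWm.aemeasurable).1 hkW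
  set E : Set ((ℝ × ℝ) × (s → ℝ × ℝ)) := {q | (∀ i, (q.2 i).1 ≤ q.1.1) ∧ q.1.2 < T} with hE
  have hEm : MeasurableSet E := by
    refine MeasurableSet.inter ?_ (measurableSet_lt measurable_fst.snd measurable_const)
    have : {q : (ℝ × ℝ) × (s → ℝ × ℝ) | ∀ i, (q.2 i).1 ≤ q.1.1} =
        ⋂ i, {q | (q.2 i).1 ≤ q.1.1} := by ext; simp
    change MeasurableSet {q : (ℝ × ℝ) × (s → ℝ × ℝ) | ∀ i, (q.2 i).1 ≤ q.1.1}
    rw [this]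
    exact MeasurableSet.iInter fun i => measurableSet_le (by fun_prop) (by fun_prop)
  have hset : MeasurableSet {z : ℝ × ℝ | z.2 < T} := measurableSet_lt measurable_snd measurable_const
  have hpre : {ω | (∀ i ∈ s, (Z i ω).1 ≤ (Z k ω).1) ∧ (Z k ω).2 < T} =
      (fun ω => (Z k ω, W ω)) ⁻¹' E := by
    ext ω
    simp [hE, hW]
  have : SFinite (P.map W) := inferInstance
  rw [hpre, ← Measure.map_apply ((hZ k).prodMk hWm) hEm, hprod, Measure.prod_apply hEm, hlaw k,
    ← lintegral_indicator hset]
  refine lintegral_congr fun z => ?_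
  have hslice : MeasurableSet (Prod.mk z ⁻¹' E) := measurable_prodMk_left hEm
  by_cases hz : z.2 < T
  · rw [Set.indicator_of_mem (by exact hz), Measure.map_apply hWm hslice]
    have hcap : W ⁻¹' (Prod.mk z ⁻¹' E) =
        ⋂ i ∈ s, Z i ⁻¹' (Prod.fst ⁻¹' Set.Iic z.1) := by
      ext ω
      simp [hE, hW, hz]
    rw [hcap, hind.measure_inter_preimage_eq_mul s
      (sets := fun _ => Prod.fst ⁻¹' Set.Iic z.1) fun i _ => measurable_fst measurableSet_Iic]
    refine Finset.prod_eq_pow_card fun i _ => ?_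
    rw [Measure.map_apply measurable_fst measurableSet_Iic, ← hlaw i,
      Measure.map_apply (hZ i) (measurable_fst measurableSet_Iic)]
  · rw [Set.indicator_of_notMem (by exact hz)]
    have : Prod.mk z ⁻¹' E = ∅ := by
      ext w
      simp [hE, hz]
    rw [this, measure_empty]

/-- Independent random variables, one of which has a diffuse law, are almost surely distinct. -/
lemma measure_eq_eq_zero_of_indepFun [MeasurableSpace Ω] {P : Measure Ω} [IsProbabilityMeasure P]
    {X Y : Ω → ℝ} (hX : Measurable X) (hY : Measurable Y)
    (hXY : IndepFun X Y P) [NullSingletonClass (P.map Y)] : P {ω | X ω = Y ω} = 0 := by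
  have hd : MeasurableSet {q : ℝ × ℝ | q.1 = q.2} := measurableSet_eq_fun measurable_fst measurable_snd
  have hpre : {ω | X ω = Y ω} = (fun ω => (X ω, Y ω)) ⁻¹' {q : ℝ × ℝ | q.1 = q.2} := rfl
  rw [hpre, ← Measure.map_apply (hX.prodMk hY) hd,
    (indepFun_iff_map_prod_eq_prod_map_map hX.aemeasurable hY.aemeasurable).1 hXY,
    Measure.measure_prod_null hd]
  refine .of_forall fun x => ?_
  have : Prod.mk x ⁻¹' {q : ℝ × ℝ | q.1 = q.2} = {x} := by
    ext y
    simp [eq_comm]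
  simp [this]

/-- The set of source-relay SNR vectors for which the decoding set equals `S`. -/
def decodingRegion (T : ℝ) (S : Finset (Fin N)) : Set (Fin N → ℝ) :=
  Set.univ.pi fun i => if i ∈ S then Set.Ioi T else Set.Iic T

lemma measurableSet_decodingRegion (T : ℝ) (S : Finset (Fin N)) :
    MeasurableSet (decodingRegion T S) :=
  MeasurableSet.univ_pi fun i => by
    split_ifs
    exacts [measurableSet_Ioi, measurableSet_Iic]

/-- Exhibits the event as a preimage under the whole source-relay vector, the form to which
independence from the second hop applies. -/
lemma decodingSet_preimage_singleton (T : ℝ) (X : Fin N → Ω → ℝ) (S : Finset (Fin N)) :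
    decodingSet T X ⁻¹' {S} = (fun ω i => X i ω) ⁻¹' decodingRegion T S := by
  ext ω
  simp only [Set.mem_preimage, Set.mem_singleton_iff, decodingRegion, Set.mem_univ_pi,
    Finset.ext_iff, decodingSet, Finset.mem_filter, Finset.mem_univ, true_and]
  refine forall_congr' fun i => ?_
  by_cases hi : i ∈ S <;> simp [hi]

lemma measure_decodingSet_eq [MeasurableSpace Ω] {P : Measure Ω}
    {X : Fin N → Ω → ℝ} (hX : ∀ i, Measurable (X i)) {ν : Measure ℝ}
    (hlaw : ∀ i, P.map (X i) = ν) (hind : iIndepFun X P) (T : ℝ) (S : Finset (Fin N)) :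
    P (decodingSet T X ⁻¹' {S}) = ν (Set.Ioi T) ^ S.card * ν (Set.Iic T) ^ (N - S.card) := by
  have hcap : decodingSet T X ⁻¹' {S} =
      ⋂ i ∈ (Finset.univ : Finset (Fin N)), X i ⁻¹' (if i ∈ S then Set.Ioi T else Set.Iic T) := by
    rw [decodingSet_preimage_singleton]
    ext ω
    simp [decodingRegion]
  have hm (i : Fin N) : MeasurableSet (if i ∈ S then Set.Ioi T else Set.Iic T) := by
    split_ifs
    exacts [measurableSet_Ioi, measurableSet_Iic]
  rw [hcap, hind.measure_inter_preimage_eq_mul Finset.univ fun i _ => hm i]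
  have hval (i : Fin N) : P (X i ⁻¹' (if i ∈ S then Set.Ioi T else Set.Iic T)) =
      if i ∈ S then ν (Set.Ioi T) else ν (Set.Iic T) := by
    rw [← Measure.map_apply (hX i) (hm i), hlaw]
    split_ifs <;> rfl
  simp_rw [hval]
  rw [Finset.prod_ite, Finset.prod_const, Finset.prod_const]
  congr 2
  · simp
  · rw [Finset.filter_not, Finset.filter_mem_eq_inter, Finset.univ_inter,
      Finset.card_univ_sdiff, Fintype.card_fin]

variable {T : ℝ} {snrSR snrRD estRD : Fin N → Ω → ℝ} {κ : Ω → Fin N}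

/-- On a nonempty decoding set `S`, the outage event is, up to ties, the disjoint union over
`k ∈ S` of the events that `k` has the largest estimated SNR and is in outage. -/
lemma outage_inter_ae_eq [MeasurableSpace Ω] {P : Measure Ω}
    (hsel : IsSelectedRelay T snrSR estRD κ)
    (hties : ∀ᵐ ω ∂P, ∀ i k, i ≠ k → estRD i ω ≠ estRD k ω)
    {S : Finset (Fin N)} (hS : S.Nonempty) :
    (decodingSet T snrSR ⁻¹' {S} ∩ {ω | endToEndSNR T snrSR snrRD κ ω < T} : Set Ω) =ᵐ[P]
      (⋃ k ∈ S, decodingSet T snrSR ⁻¹' {S} ∩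
        {ω | (∀ i ∈ S.erase k, estRD i ω ≤ estRD k ω) ∧ snrRD k ω < T} : Set Ω) := by
  refine Filter.eventuallyEq_set.2 ?_
  filter_upwards [hties] with ω hω
  simp only [Set.mem_inter_iff, Set.mem_preimage, Set.mem_singleton_iff, Set.mem_ofPred_eq,
    Set.mem_iUnion, exists_prop]
  constructor
  · rintro ⟨hd, ho⟩
    have hne : (decodingSet T snrSR ω).Nonempty := hd ▸ hS
    obtain ⟨hmem, hmax⟩ := hsel ω hne
    rw [endToEndSNR, if_pos hne, min_lt_iff] at ho
    -- A decoding relay has its first hop above `T`, so only the second hop can bring the minimum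
    -- below `T`.
    have hgt : T < snrSR (κ ω) ω := by simpa [decodingSet] using hmem
    refine ⟨κ ω, hd ▸ hmem, hd, fun i hi => ?_, ho.resolve_left hgt.not_gt⟩
    exact hmax i (hd ▸ Finset.mem_of_mem_erase hi)
  · rintro ⟨k, hk, hd, hmax, hlt⟩
    have hne : (decodingSet T snrSR ω).Nonempty := hd ▸ hS
    obtain ⟨hmem, hκmax⟩ := hsel ω hne
    rw [hd] at hmem hκmax
    have hκk : κ ω = k := by
      by_contra hne'
      exact hω _ _ hne' ((hmax _ (Finset.mem_erase.2 ⟨hne', hmem⟩)).antisymm (hκmax k hk))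
    refine ⟨hd, ?_⟩
    rw [endToEndSNR, if_pos hne, hκk]
    exact min_lt_of_right_lt hlt

/-- Serves both on `Ω` and, with coordinate maps, on the space of vectors of pairs. -/
lemma measurableSet_max_and_lt [MeasurableSpace Ω]
    (hRD : ∀ i, Measurable (snrRD i)) (hest : ∀ i, Measurable (estRD i))
    (T : ℝ) (s : Finset (Fin N)) (k : Fin N) :
    MeasurableSet {ω | (∀ i ∈ s, estRD i ω ≤ estRD k ω) ∧ snrRD k ω < T} := by
  refine MeasurableSet.inter ?_ (measurableSet_lt (hRD k) measurable_const)
  have : {ω | ∀ i ∈ s, estRD i ω ≤ estRD k ω} = ⋂ i ∈ s, {ω | estRD i ω ≤ estRD k ω} := by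
    ext
    simp
  change MeasurableSet {ω | ∀ i ∈ s, estRD i ω ≤ estRD k ω}
  rw [this]
  exact Finset.measurableSet_biInter s fun i _ => measurableSet_le (hest i) (hest k)

/-- The probability of an outage on the event that the decoding set is a given nonempty set. -/
lemma measure_outage_inter [MeasurableSpace Ω] {P : Measure Ω} [IsProbabilityMeasure P]
    {μ : Measure (ℝ × ℝ)} {ν : Measure ℝ}
    (hSR : ∀ i, Measurable (snrSR i)) (hRD : ∀ i, Measurable (snrRD i))
    (hest : ∀ i, Measurable (estRD i))
    (hlawSR : ∀ i, P.map (snrSR i) = ν)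
    (hlawRD : ∀ i, P.map (fun ω => (estRD i ω, snrRD i ω)) = μ)
    [NullSingletonClass (μ.map Prod.fst)]
    (hindSR : iIndepFun snrSR P)
    (hindRD : iIndepFun (fun (i : Fin N) (ω : Ω) => (estRD i ω, snrRD i ω)) P)
    (hind : IndepFun (fun ω i => snrSR i ω) (fun ω i => (estRD i ω, snrRD i ω)) P)
    (hsel : IsSelectedRelay T snrSR estRD κ) {S : Finset (Fin N)} (hS : S.Nonempty) :
    P (decodingSet T snrSR ⁻¹' {S} ∩ {ω | endToEndSNR T snrSR snrRD κ ω < T}) =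
      S.card * (ν (Set.Ioi T) ^ S.card * ν (Set.Iic T) ^ (N - S.card) *
        ∫⁻ z in {z : ℝ × ℝ | z.2 < T}, μ.map Prod.fst (Set.Iic z.1) ^ (S.card - 1) ∂μ) := by
  have hpair (i : Fin N) : Measurable fun ω => (estRD i ω, snrRD i ω) := (hest i).prodMk (hRD i)
  have hlawE (i : Fin N) : P.map (estRD i) = μ.map Prod.fst := by
    rw [← hlawRD i, Measure.map_map measurable_fst (hpair i)]
    rfl
  have htie (i k : Fin N) (hik : i ≠ k) : P {ω | estRD i ω = estRD k ω} = 0 := by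
    have : NullSingletonClass (P.map (estRD k)) := by
      rw [hlawE]
      infer_instance
    exact measure_eq_eq_zero_of_indepFun (hest i) (hest k)
      ((hindRD.indepFun hik).comp measurable_fst measurable_fst)
  have hties : ∀ᵐ ω ∂P, ∀ i k, i ≠ k → estRD i ω ≠ estRD k ω := by
    rw [ae_all_iff]
    intro i
    rw [ae_all_iff]
    intro k
    by_cases hik : i = k
    · simp [hik]
    · simpa [hik, ae_iff] using htie i k hik
  have hA : MeasurableSet (decodingSet T snrSR ⁻¹' {S}) := by
    rw [decodingSet_preimage_singleton]
    exact (measurable_pi_lambda _ fun i => hSR i) (measurableSet_decodingRegion T S)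
  rw [measure_congr (outage_inter_ae_eq hsel hties hS), measure_biUnion_finset₀]
  · rw [← nsmul_eq_mul]
    refine Finset.sum_eq_card_nsmul fun k hk => ?_
    rw [← measure_decodingSet_eq hSR hlawSR hindSR T S, ← Finset.card_erase_of_mem hk,
      ← measure_max_fst_and_snd_lt hpair hlawRD hindRD (Finset.notMem_erase k S),
      decodingSet_preimage_singleton]
    exact hind.measure_inter_preimage_eq_mul _
      {v : Fin N → ℝ × ℝ | (∀ i ∈ S.erase k, (v i).1 ≤ (v k).1) ∧ (v k).2 < T}
      (measurableSet_decodingRegion T S)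
      (measurableSet_max_and_lt (fun i => (measurable_pi_apply i).snd)
        (fun i => (measurable_pi_apply i).fst) T (S.erase k) k)
  -- The events for distinct `k` are disjoint only almost everywhere: an overlap forces a tie.
  · intro k hk k' hk' hne
    refine measure_mono_null ?_ (htie k k' hne)
    rintro ω ⟨⟨-, h, -⟩, -, h', -⟩
    exact (h' k (Finset.mem_erase.2 ⟨hne, hk⟩)).antisymm (h k' (Finset.mem_erase.2 ⟨hne.symm, hk'⟩))
  · exact fun k _ => (hA.inter (measurableSet_max_and_lt hRD hest T _ k)).nullMeasurableSet

/-- The outage probability as a sum over the size of the decoding set. -/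
lemma outageProbability_eq_sum [MeasurableSpace Ω] {P : Measure Ω} [IsProbabilityMeasure P]
    {μ : Measure (ℝ × ℝ)} {ν : Measure ℝ} (hT : 0 < T)
    (hSR : ∀ i, Measurable (snrSR i)) (hRD : ∀ i, Measurable (snrRD i))
    (hest : ∀ i, Measurable (estRD i))
    (hlawSR : ∀ i, P.map (snrSR i) = ν)
    (hlawRD : ∀ i, P.map (fun ω => (estRD i ω, snrRD i ω)) = μ)
    [NullSingletonClass (μ.map Prod.fst)]
    (hindSR : iIndepFun snrSR P)
    (hindRD : iIndepFun (fun (i : Fin N) (ω : Ω) => (estRD i ω, snrRD i ω)) P)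
    (hind : IndepFun (fun ω i => snrSR i ω) (fun ω i => (estRD i ω, snrRD i ω)) P)
    (hsel : IsSelectedRelay T snrSR estRD κ) :
    outageProbability P T snrSR snrRD κ = ν.real (Set.Iic T) ^ N +
      ∑ l ∈ Finset.Icc 1 N, (l : ℝ) * (N.choose l : ℝ) * ν.real (Set.Iic T) ^ (N - l) *
        ν.real (Set.Ioi T) ^ l *
        (∫⁻ z in {z : ℝ × ℝ | z.2 < T}, μ.map Prod.fst (Set.Iic z.1) ^ (l - 1) ∂μ).toReal := by
  set O : Set Ω := {ω | endToEndSNR T snrSR snrRD κ ω < T} with hO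
  have hA (S : Finset (Fin N)) : MeasurableSet (decodingSet T snrSR ⁻¹' {S}) := by
    rw [decodingSet_preimage_singleton]
    exact (measurable_pi_lambda _ fun i => hSR i) (measurableSet_decodingRegion T S)
  have hsum : P.real O = ∑ S : Finset (Fin N), P.real (decodingSet T snrSR ⁻¹' {S} ∩ O) := by
    -- Restricting `P` to `O` requires only the fibres of the decoding set to be measurable, not `O`
    -- itself.
    have h := sum_measure_preimage_singleton (μ := P.restrict O) (f := decodingSet T snrSR)
      (Finset.univ : Finset (Finset (Fin N))) fun S _ => hA S
    simp only [Finset.coe_univ, Set.preimage_univ, Measure.restrict_apply_univ,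
      fun S => Measure.restrict_apply (μ := P) (s := O) (hA S)] at h
    simp only [measureReal_def, ← h]
    exact ENNReal.toReal_sum fun S _ => measure_ne_top _ _
  -- The case `l = 0` is separate: an empty decoding set is always in outage, while the general
  -- formula would give `0`.
  set f : ℕ → ℝ := fun l => if l = 0 then ν.real (Set.Iic T) ^ N else
    (l : ℝ) * (ν.real (Set.Ioi T) ^ l * ν.real (Set.Iic T) ^ (N - l) *
      (∫⁻ z in {z : ℝ × ℝ | z.2 < T}, μ.map Prod.fst (Set.Iic z.1) ^ (l - 1) ∂μ).toReal) with hf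
  have hval (S : Finset (Fin N)) : P.real (decodingSet T snrSR ⁻¹' {S} ∩ O) = f S.card := by
    rcases S.eq_empty_or_nonempty with rfl | hS
    · have hsub : decodingSet T snrSR ⁻¹' {∅} ⊆ O := by
        intro ω hω
        have hω' : decodingSet T snrSR ω = ∅ := hω
        simp [hO, endToEndSNR, hω', hT]
      rw [Set.inter_eq_left.2 hsub, measureReal_def,
        measure_decodingSet_eq hSR hlawSR hindSR T ∅]
      simp [hf, measureReal_def]
    · rw [measureReal_def, measure_outage_inter hSR hRD hest hlawSR hlawRD hindSR hindRD hind hsel hS]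
      simp [hf, measureReal_def, hS.ne_empty]
  -- Grouping the subsets by cardinality produces the binomial coefficients.
  rw [outageProbability, hsum, Finset.sum_congr rfl fun S _ => hval S, ← Finset.powerset_univ,
    Finset.sum_powerset_apply_card, Finset.card_univ, Fintype.card_fin, Finset.sum_range_succ',
    add_comm, show Finset.Icc 1 N = Finset.Ico (0 + 1) (N + 1) by ext; simp,
    ← Finset.sum_Ico_add', ← Finset.range_eq_Ico]
  congr 1
  · simp [hf]
  · refine Finset.sum_congr rfl fun l _ => ?_
    simp only [hf, nsmul_eq_mul, if_neg l.succ_ne_zero]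
    ring

end Probability

end RelaySelection

/-! ### The main theorem. -/

theorem mainTheorem2 {Ω : Type*} [MeasurableSpace Ω] (P : Measure Ω) [IsProbabilityMeasure P]
    (N m : ℕ) (hm : 1 ≤ m) (g ρ T : ℝ) (hg : 0 < g) (hρ0 : 0 ≤ ρ) (hρ1 : ρ < 1) (hT : 0 < T)
    (snrSR snrRD estRD : Fin N → Ω → ℝ) (κ : Ω → Fin N)
    (hSR : ∀ i, Measurable (snrSR i)) (hRD : ∀ i, Measurable (snrRD i))
    (hest : ∀ i, Measurable (estRD i)) (hκ : Measurable κ)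
    (hlawSR : ∀ i, P.map (snrSR i) = gammaMeasure (m : ℝ) (m / g))
    (hlawRD : ∀ i, P.map (fun ω => (estRD i ω, snrRD i ω)) =
      RelaySelection.bivariateGammaMeasure m g ρ)
    (hindSR : iIndepFun snrSR P)
    (hindRD : iIndepFun (fun (i : Fin N) (ω : Ω) => (estRD i ω, snrRD i ω)) P)
    (hind : IndepFun (fun ω i => snrSR i ω) (fun ω i => (estRD i ω, snrRD i ω)) P)
    (hsel : RelaySelection.IsSelectedRelay T snrSR estRD κ) :
    Summable (RelaySelection.outageTerm N m g ρ T) ∧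
    RelaySelection.outageProbability P T snrSR snrRD κ =
      (1 - RelaySelection.upperGamma m (m / g * T) / Real.Gamma m) ^ N +
        ∑' j : ℕ, RelaySelection.outageTerm N m g ρ T j ∧
    ∀ j i : ℕ,
      RelaySelection.auxIntegral (m + j - 1) (m / (g * (1 - ρ))) m (m / g) i =
        Real.Gamma m ^ i * (g / m) ^ (m + j) * RelaySelection.psi m (m + j) ρ i := by
  open RelaySelection in
  have hm0 : (0 : ℝ) < m := by exact_mod_cast hm
  have hβ0 : (0 : ℝ) < m / g := div_pos hm0 hg
  have hmarg := map_fst_bivariateGammaMeasure hm hg hρ0 hρ1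
  -- A sample point supplies an index `κ ω₀ : Fin N`, so the bivariate measure is the law of some
  -- pair and hence finite.
  obtain ⟨ω₀⟩ := nonempty_of_isProbabilityMeasure P
  have : IsFiniteMeasure (bivariateGammaMeasure m g ρ) := by
    rw [← hlawRD (κ ω₀)]
    infer_instance
  have : NullSingletonClass ((bivariateGammaMeasure m g ρ).map Prod.fst) := by
    rw [hmarg]
    infer_instance
  have hsum : HasSum (outageTerm N m g ρ T) _ :=
    (hasSum_sum fun l _ => (hasSum_selectionTerm hm hg hρ0 hρ1 T (l - 1)).mul_left
      ((l : ℝ) * (N.choose l : ℝ) * (1 - upperGamma m (m / g * T) / Real.Gamma m) ^ (N - l) *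
        (upperGamma m (m / g * T) / Real.Gamma m) ^ l)).congr_fun
      fun j => outageTerm_eq_sum_selectionTerm (N := N) hm hg hρ1 hT j
  refine ⟨hsum.summable, ?_, auxIntegral_eq_psi hm hg hρ1⟩
  rw [hsum.tsum_eq, outageProbability_eq_sum hT hSR hRD hest hlawSR hlawRD hindSR hindRD hind hsel,
    hmarg, gammaMeasure_real_Iic hm0 hβ0 hT.le, gammaMeasure_real_Ioi hm0 hβ0 hT.le]
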